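/- **Setting.** Fix a well-formed signature $\Sigma$ of canonical LF. For a type, $\mathrm{hd}(a\,M_1\cdots M_n)=a$ and $\mathrm{hd}(\Pi x{:}A.B)=\mathrm{hd}(B)$. Let $\preceq$ be the smallest reflexive and transitive relation on the type constants declared in $\Sigma$ such that $\mathrm{hd}(A_i)\preceq a$ for each declaration $a:\Pi x_1{:}A_1\ldots\Pi x_n{:}A_n.\mathrm{Type}$ and $\mathrm{hd}(A_i)\preceq\mathrm{hd}(A)$ for each declaration $c:\Pi x_1{:}A_1\ldots\Pi x_n{:}A_n.A$ ($1\le i\le n$); for types, $A\preceq B$ means $\mathrm{hd}(A)\preceq\mathrm{hd}(B)$. A type *respects subordination* if $A\preceq B$ for every product $\Pi x{:}A.B$ occurring in it. Assume that all types in the declarations of $\Sigma$ (including the argument types in kinds) respect subordination. Arity types are the simple types over one base type $o$; the erasure of a type is given by $P^-=o$ for atomic $P$ and $(\Pi x{:}A.B)^-=A^-\to B^-$. The variables declared in LF contexts are nominal constants $n$, each with a fixed arity type, infinitely many for each arity type. $E[\theta]$ denotes hereditary substitution. **Schemas.** A block schema $\mathcal B=\{x_1{:}\alpha_1,\ldots,x_n{:}\alpha_n\}\Delta$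 consists of parameters $x_i$ with arity types and a block declaration $\Delta=y_1{:}A_1,\ldots,y_m{:}A_m$; it is well-formed if all the $x_i,y_j$ are distinct and each $A_j$ is well-kinded in the arity sense over $\Sigma$, the parameters, and $y_1{:}A_1^-,\ldots,y_{j-1}{:}A_{j-1}^-$. A context schema is a finite sequence of block schemas, well-formed if each of them is. An instance of $\mathcal B$ is obtained by replacing, in $\Delta$, each $y_j$ by a nominal constant of arity type $A_j^-$ and then each $x_i$ by a closed term (over $\Sigma$ and the nominal constants) of arity type $\alpha_i$. An instance of $\mathcal C$ is a concatenation $G_1,\ldots,G_r$ ($r\ge 0$) of instances of block schemas in $\mathcal C$. **Relations.** Let $F$ be a formula of $\mathcal L_{LF}$ (built from atoms $\{G\vdash M:A\}$, $\top,\bot,\supset,\wedge,\vee$, the term quantifiers $\forall x{:}\alpha$, $\exists x{:}\alpha$ and the context quantifiers $\Pi\Gamma{:}\mathcal C$) and $\Gamma$ a context variable. A type $A$ is *subordinate to $F$ relative to $\Gamma$* if $F$ contains, outside the scope of any quantifier that binds $\Gamma$, an atom $\{\Gamma\vdash M:A'\}$ with $A\preceq A'$, or an atom $\{\Gamma,n_1{:}A_1,\ldots,n_k{:}A_k\vdash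 M:A'\}$ with $k\ge1$. For sequences $D,D'$ of bindings (context expressions or block declarations): * *$D$ subsumes $D'$ relative to $F$ and $\Gamma$* if $D$ results from $D'$ by dropping some bindings whose types are not subordinate to $F$ relative to $\Gamma$; * *$D$ is a pruning of $D'$ relative to $\mathcal C$* if $D$ results from $D'$ by dropping some bindings $x{:}A$ such that $A\not\preceq A'$ for every type $A'$ assigned in a block declaration of $\mathcal C$. A *variant* of a block schema is its image under a finitely supported permutation of the variables. The context schema $\mathcal C$ *subsumes* $\mathcal C'$ relative to $F$ and $\Gamma$ if every block schema of $\mathcal C'$ has a variant $\mathcal B'=\{\ldots\}\Delta'$ for which there is a block schema $\mathcal B=\{\ldots\}\Delta$ in $\mathcal C$ such that every variable that is a parameter or a declared variable both of $\mathcal B$ and of $\mathcal B'$ has the same arity type in both (that of a declared variable being the erasure of its type), $\Delta$ is a pruning of $\Delta'$ relative to $\mathcal C$, and $\Delta$ subsumes $\Delta'$ relative to $F$ and $\Gamma$. **Theorem.** Let $F$ be a formula, $\Gamma$ a context variable, and $\mathcal C,\mathcal C'$ well-formed context schemas such that $\mathcal C$ subsumes $\mathcal C'$ relative to $F$ and $\Gamma$.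 Let $G'$ be an instance of $\mathcal C'$ that is a well-formed LF context ($\vdash_\Sigma G'\ \mathrm{ctx}$) and all of whose types respect subordination. Then there is an instance $G$ of $\mathcal C$ such that $\vdash_\Sigma G\ \mathrm{ctx}$, $G$ subsumes $G'$ relative to $F$ and $\Gamma$, and $G$ is a pruning of $G'$ relative to $\mathcal C$. -/

import Mathlib

namespace LLF

/-! ### Expressions of canonical LF

Free term variables are named, variables bound by an abstraction or a product are de Bruijn
indices, and the variables declared by an LF context are nominal constants. -/

/-- Arity types: simple types over one atomic type. -/
inductive Arity : Type
  | o : Arity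
  | arr : Arity → Arity → Arity

/-- Names of term constants. -/
abbrev TmConst := ℕ
/-- Names of type constants. -/
abbrev TyConst := ℕ
/-- Names of term variables. -/
abbrev Var := ℕ
/-- Names of context variables. -/
abbrev CtxVar := ℕ

/-- Nominal constants: each carries its arity type, and there are denumerably many of every
arity type. -/
structure Nom : Type where
  index : ℕ
  arity : Arity

mutual
/-- Canonical terms `M ::= R | λx. M`. -/
inductive Tm : Type
  | atm : Atm → Tm
  | lam : Tm → Tm
/-- Atomic terms `R ::= c | x | n | R M`, where `bvar i` is a bound variable. -/
inductive Atm : Type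
  | const : TmConst → Atm
  | var : Var → Atm
  | nom : Nom → Atm
  | bvar : ℕ → Atm
  | app : Atm → Tm → Atm
end

/-- Atomic type families `P ::= a | P M`. -/
inductive Fam : Type
  | const : TyConst → Fam
  | app : Fam → Tm → Fam

/-- Canonical types `A ::= P | Πx:A. B`. -/
inductive Ty : Type
  | fam : Fam → Ty
  | pi : Ty → Ty → Ty

/-- Kinds `K ::= Type | Πx:A. K`. -/
inductive Kind : Type
  | type : Kind
  | pi : Ty → Kind → Kind

/-- Declarations `c : A` and `a : K` of a signature. -/
inductive Decl : Type
  | tm : TmConst → Ty → Decl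
  | ty : TyConst → Kind → Decl

/-- Signatures, latest declaration first. -/
abbrev Signature := List Decl

/-- Sequences of type assignments to objects of sort `ι`, latest first: `(x, A) :: D` is `D, x:A`
and `E ++ D` is `D, E`. -/
abbrev Bindings (ι : Type) := List (ι × Ty)

/-- LF contexts, that is, closed context expressions. -/
abbrev Ctx := Bindings Nom

/-- Erasure of a type to an arity type. -/
def Ty.erase : Ty → Arity
  | .fam _ => .o
  | .pi A B => .arr A.erase B.erase

/-- The type constant at the head of an atomic type family. -/
def Fam.head : Fam → TyConst
  | .const a => a
  | .app P _ => P.head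

/-- The type constant at the head of a type. -/
def Ty.head : Ty → TyConst
  | .fam P => P.head
  | .pi _ B => B.head

/-- The list `A₁, …, Aₙ` for the type `Πx₁:A₁. … Πxₙ:Aₙ. P`. -/
def Ty.doms : Ty → List Ty
  | .fam _ => []
  | .pi A B => A :: B.doms

/-- The list `A₁, …, Aₙ` for the kind `Πx₁:A₁. … Πxₙ:Aₙ. Type`. -/
def Kind.doms : Kind → List Ty
  | .type => []
  | .pi A K => A :: K.doms

/-! ### Operations on bound variables, nominal constants and names -/

mutual
/-- Increment the bound variables with index at least `k`. -/
def Tm.shift (k : ℕ) : Tm → Tm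
  | .atm R => .atm (R.shift k)
  | .lam M => .lam (M.shift (k + 1))
/-- Increment the bound variables with index at least `k`. -/
def Atm.shift (k : ℕ) : Atm → Atm
  | .const c => .const c
  | .var x => .var x
  | .nom n => .nom n
  | .bvar i => .bvar (if i < k then i else i + 1)
  | .app R M => .app (R.shift k) (M.shift k)
end

mutual
/-- Replace the bound variable `k` by the nominal constant `n`. -/
def Tm.openNom (n : Nom) (k : ℕ) : Tm → Tm
  | .atm R => .atm (R.openNom n k)
  | .lam M => .lam (M.openNom n (k + 1))
/-- Replace the bound variable `k` by the nominal constant `n`. -/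
def Atm.openNom (n : Nom) (k : ℕ) : Atm → Atm
  | .const c => .const c
  | .var x => .var x
  | .nom m => .nom m
  | .bvar i => if i = k then .nom n else .bvar i
  | .app R M => .app (R.openNom n k) (M.openNom n k)
end

/-- Replace the bound variable `k` by the nominal constant `n`. -/
def Fam.openNom (n : Nom) (k : ℕ) : Fam → Fam
  | .const a => .const a
  | .app P M => .app (P.openNom n k) (M.openNom n k)

/-- Replace the bound variable `k` by the nominal constant `n`. -/
def Ty.openNom (n : Nom) (k : ℕ) : Ty → Ty
  | .fam P => .fam (P.openNom n k)
  | .pi A B => .pi (A.openNom n k) (B.openNom n (k + 1))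

/-- Replace the bound variable `k` by the nominal constant `n`. -/
def Kind.openNom (n : Nom) (k : ℕ) : Kind → Kind
  | .type => .type
  | .pi A K => .pi (A.openNom n k) (K.openNom n (k + 1))

mutual
/-- The nominal constant `n` does not occur in the term. -/
def Tm.Fresh (n : Nom) : Tm → Prop
  | .atm R => R.Fresh n
  | .lam M => M.Fresh n
/-- The nominal constant `n` does not occur in the atomic term. -/
def Atm.Fresh (n : Nom) : Atm → Prop
  | .const _ => True
  | .var _ => True
  | .nom m => m ≠ n
  | .bvar _ => True
  | .app R M => R.Fresh n ∧ M.Fresh n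
end

/-- The nominal constant `n` does not occur in the family. -/
def Fam.Fresh (n : Nom) : Fam → Prop
  | .const _ => True
  | .app P M => P.Fresh n ∧ M.Fresh n

/-- The nominal constant `n` does not occur in the type. -/
def Ty.Fresh (n : Nom) : Ty → Prop
  | .fam P => P.Fresh n
  | .pi A B => A.Fresh n ∧ B.Fresh n

/-- The nominal constant `n` does not occur in the kind. -/
def Kind.Fresh (n : Nom) : Kind → Prop
  | .type => True
  | .pi A K => A.Fresh n ∧ K.Fresh n

mutual
/-- Rename the free variables by `p`. -/
def Tm.rename (p : Var → Var) : Tm → Tm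
  | .atm R => .atm (R.rename p)
  | .lam M => .lam (M.rename p)
/-- Rename the free variables by `p`. -/
def Atm.rename (p : Var → Var) : Atm → Atm
  | .const c => .const c
  | .var x => .var (p x)
  | .nom n => .nom n
  | .bvar i => .bvar i
  | .app R M => .app (R.rename p) (M.rename p)
end

/-- Rename the free variables by `p`. -/
def Fam.rename (p : Var → Var) : Fam → Fam
  | .const a => .const a
  | .app P M => .app (P.rename p) (M.rename p)

/-- Rename the free variables by `p`. -/
def Ty.rename (p : Var → Var) : Ty → Ty
  | .fam P => .fam (P.rename p)
  | .pi A B => .pi (A.rename p) (B.rename p)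

/-! ### Hereditary substitution -/

/-- A substitution `{⟨x₁, M₁, α₁⟩, …, ⟨xₙ, Mₙ, αₙ⟩}` for named variables. -/
abbrev Subst := List (Var × Tm × Arity)

/-- What a simultaneous substitution does to the named variables (replace, or keep) and to the
bound variables (replace, or renumber). -/
structure Env : Type where
  nm : Var → Option (Tm × Arity)
  ix : ℕ → (Tm × Arity) ⊕ ℕ

/-- The environment of a substitution for named variables. -/
def Env.ofSubst (θ : Subst) : Env where
  nm x := θ.lookup x
  ix i := .inr i

/-- The environment that replaces the bound variable `0` by `M` at arity type `α`. -/
def Env.inst (M : Tm) (α : Arity) : Env where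
  nm _ := none
  ix i := match i with
    | 0 => .inl (M, α)
    | j + 1 => .inr j

/-- The environment to be used below one more binder. -/
def Env.up (ε : Env) : Env where
  nm x := (ε.nm x).map fun p => (p.1.shift 0, p.2)
  ix i := match i with
    | 0 => .inr 0
    | j + 1 => (ε.ix j).map (fun p => (p.1.shift 0, p.2)) (· + 1)

mutual
/-- `SubTm ε M M'`: the hereditary substitution `ε` applied to `M` yields the canonical
term `M'`. -/
inductive SubTm : Env → Tm → Tm → Prop
  | atm {ε : Env} {R : Atm} {M : Tm} {r : Option Arity} :
      SubAtm ε R M r → SubTm ε (.atm R) M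
  | lam {ε : Env} {M M' : Tm} :
      SubTm ε.up M M' → SubTm ε (.lam M) (.lam M')
/-- `SubAtm ε R M r`: the hereditary substitution `ε` applied to `R` yields `M`; if the head of
`R` has been replaced, then `r` is the arity type at which the result is governed, and
otherwise `r` is `none`. -/
inductive SubAtm : Env → Atm → Tm → Option Arity → Prop
  | const {ε : Env} {c : TmConst} : SubAtm ε (.const c) (.atm (.const c)) none
  | nom {ε : Env} {n : Nom} : SubAtm ε (.nom n) (.atm (.nom n)) none
  | varKeep {ε : Env} {x : Var} :
      ε.nm x = none → SubAtm ε (.var x) (.atm (.var x)) none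
  | varRepl {ε : Env} {x : Var} {M : Tm} {α : Arity} :
      ε.nm x = some (M, α) → SubAtm ε (.var x) M (some α)
  | bvarKeep {ε : Env} {i j : ℕ} :
      ε.ix i = .inr j → SubAtm ε (.bvar i) (.atm (.bvar j)) none
  | bvarRepl {ε : Env} {i : ℕ} {M : Tm} {α : Arity} :
      ε.ix i = .inl (M, α) → SubAtm ε (.bvar i) M (some α)
  | appKeep {ε : Env} {R R' : Atm} {M M' : Tm} :
      SubAtm ε R (.atm R') none → SubTm ε M M' →
      SubAtm ε (.app R M) (.atm (.app R' M')) none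
  | appAtm {ε : Env} {R R' : Atm} {M M' : Tm} {α β : Arity} :
      SubAtm ε R (.atm R') (some (.arr α β)) → SubTm ε M M' →
      SubAtm ε (.app R M) (.atm (.app R' M')) (some β)
  | appLam {ε : Env} {R : Atm} {M M' N N' : Tm} {α β : Arity} :
      SubAtm ε R (.lam N) (some (.arr α β)) → SubTm ε M M' →
      SubTm (Env.inst M' α) N N' →
      SubAtm ε (.app R M) N' (some β)
end

/-- Hereditary substitution in atomic type families. -/
inductive SubFam : Env → Fam → Fam → Prop
  | const {ε : Env} {a : TyConst} : SubFam ε (.const a) (.const a)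
  | app {ε : Env} {P P' : Fam} {M M' : Tm} :
      SubFam ε P P' → SubTm ε M M' → SubFam ε (.app P M) (.app P' M')

/-- Hereditary substitution in types. -/
inductive SubTy : Env → Ty → Ty → Prop
  | fam {ε : Env} {P P' : Fam} : SubFam ε P P' → SubTy ε (.fam P) (.fam P')
  | pi {ε : Env} {A A' B B' : Ty} :
      SubTy ε A A' → SubTy ε.up B B' → SubTy ε (.pi A B) (.pi A' B')

/-- Hereditary substitution in kinds. -/
inductive SubKind : Env → Kind → Kind → Prop
  | type {ε : Env} : SubKind ε .type .type
  | pi {ε : Env} {A A' : Ty} {K K' : Kind} :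
      SubTy ε A A' → SubKind ε.up K K' → SubKind ε (.pi A K) (.pi A' K')

/-! ### The typing judgements of LF -/

mutual
/-- `Check S G M A`: the canonical term `M` has type `A`, written `G ⊢ M ⇐ A`. -/
inductive Check (S : Signature) : Ctx → Tm → Ty → Prop
  | atm {G : Ctx} {R : Atm} {P : Fam} :
      Synth S G R (.fam P) → Check S G (.atm R) (.fam P)
  | lam {G : Ctx} {M : Tm} {A B : Ty} (n : Nom) :
      n.arity = A.erase → n ∉ G.map Prod.fst → M.Fresh n → B.Fresh n →
      Check S ((n, A) :: G) (M.openNom n 0) (B.openNom n 0) →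
      Check S G (.lam M) (.pi A B)
/-- `Synth S G R A`: the atomic term `R` has type `A`, written `G ⊢ R ⇒ A`. -/
inductive Synth (S : Signature) : Ctx → Atm → Ty → Prop
  | const {G : Ctx} {c : TmConst} {A : Ty} :
      Decl.tm c A ∈ S → Synth S G (.const c) A
  | nom {G : Ctx} {n : Nom} {A : Ty} :
      (n, A) ∈ G → Synth S G (.nom n) A
  | app {G : Ctx} {R : Atm} {M : Tm} {A B B' : Ty} :
      Synth S G R (.pi A B) → Check S G M A → SubTy (Env.inst M A.erase) B B' →
      Synth S G (.app R M) B'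
end

/-- `SynthKind S G P K`: the atomic type family `P` has kind `K`. -/
inductive SynthKind (S : Signature) : Ctx → Fam → Kind → Prop
  | const {G : Ctx} {a : TyConst} {K : Kind} :
      Decl.ty a K ∈ S → SynthKind S G (.const a) K
  | app {G : Ctx} {P : Fam} {M : Tm} {A : Ty} {K K' : Kind} :
      SynthKind S G P (.pi A K) → Check S G M A → SubKind (Env.inst M A.erase) K K' →
      SynthKind S G (.app P M) K'

/-- `TyWf S G A`: the type `A` is well-formed, written `G ⊢ A type`. -/
inductive TyWf (S : Signature) : Ctx → Ty → Prop
  | fam {G : Ctx} {P : Fam} : SynthKind S G P .type → TyWf S G (.fam P)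
  | pi {G : Ctx} {A B : Ty} (n : Nom) :
      TyWf S G A → n.arity = A.erase → n ∉ G.map Prod.fst → B.Fresh n →
      TyWf S ((n, A) :: G) (B.openNom n 0) → TyWf S G (.pi A B)

/-- `KindWf S G K`: the kind `K` is well-formed, written `G ⊢ K kind`. -/
inductive KindWf (S : Signature) : Ctx → Kind → Prop
  | type {G : Ctx} : KindWf S G .type
  | pi {G : Ctx} {A : Ty} {K : Kind} (n : Nom) :
      TyWf S G A → n.arity = A.erase → n ∉ G.map Prod.fst → K.Fresh n →
      KindWf S ((n, A) :: G) (K.openNom n 0) → KindWf S G (.pi A K)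

/-- `CtxWf S G`: the context `G` is well-formed, written `⊢ G ctx`. -/
inductive CtxWf (S : Signature) : Ctx → Prop
  | nil : CtxWf S []
  | cons {G : Ctx} {n : Nom} {A : Ty} :
      CtxWf S G → n.arity = A.erase → n ∉ G.map Prod.fst → TyWf S G A →
      CtxWf S ((n, A) :: G)

/-- `SigWf S`: the signature `S` is well-formed, written `⊢ S sig`. -/
inductive SigWf : Signature → Prop
  | nil : SigWf []
  | tm {S : Signature} {c : TmConst} {A : Ty} :
      SigWf S → (∀ A', Decl.tm c A' ∉ S) → TyWf S [] A → SigWf (Decl.tm c A :: S)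
  | ty {S : Signature} {a : TyConst} {K : Kind} :
      SigWf S → (∀ K', Decl.ty a K' ∉ S) → KindWf S [] K → SigWf (Decl.ty a K :: S)

/-! ### Subordination -/

/-- The subordination relation between type constants induced by a signature. -/
inductive Subord (S : Signature) : TyConst → TyConst → Prop
  | indexTy {a : TyConst} {K : Kind} {A : Ty} :
      Decl.ty a K ∈ S → A ∈ K.doms → Subord S A.head a
  | indexTm {c : TmConst} {A B : Ty} :
      Decl.tm c B ∈ S → A ∈ B.doms → Subord S A.head B.head
  | refl {a : TyConst} {K : Kind} : Decl.ty a K ∈ S → Subord S a a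
  | trans {a b c : TyConst} : Subord S a b → Subord S b c → Subord S a c

/-- Subordination between types. -/
def TySubord (S : Signature) (A B : Ty) : Prop := Subord S A.head B.head

/-- A type respects subordination: `A ⪯ B` for every product `Πx:A. B` in it. -/
def Ty.Respects (S : Signature) : Ty → Prop
  | .fam _ => True
  | .pi A B => TySubord S A B ∧ A.Respects S ∧ B.Respects S

/-- All types in the declarations of the signature respect the subordination relation that
it induces. -/
def Signature.Respects (S : Signature) : Prop :=
  (∀ c A, Decl.tm c A ∈ S → A.Respects S) ∧
  (∀ a K, Decl.ty a K ∈ S → ∀ A ∈ K.doms, A.Respects S)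

/-- All types assigned by the context respect subordination. -/
def Ctx.Respects (S : Signature) (G : Ctx) : Prop :=
  ∀ b ∈ G, b.2.Respects S

/-! ### Arity typing and arity kinding -/

/-- The symbols to which arity contexts assign arity types. -/
inductive Sym : Type
  | const : TmConst → Sym
  | nom : Nom → Sym
  | var : Var → Sym

/-- Arity contexts. -/
abbrev ArityCtx := Set (Sym × Arity)

/-- The arity context induced by a signature. -/
def Signature.arityCtx (S : Signature) : ArityCtx :=
  {e | ∃ c A, Decl.tm c A ∈ S ∧ e = (Sym.const c, A.erase)}

/-- The arity context formed by all the nominal constants. -/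
def nomCtx : ArityCtx := {e | ∃ n : Nom, e = (Sym.nom n, n.arity)}

/-- The arity context given by a list of variables with arity types. -/
def paramCtx (xs : List (Var × Arity)) : ArityCtx :=
  {e | ∃ p ∈ xs, e = (Sym.var p.1, p.2)}

mutual
/-- `ArTm Θ Φ M α`: the canonical term `M` has arity type `α`; the list `Φ` gives the arity types
of the bound variables. -/
inductive ArTm (Θ : ArityCtx) : List Arity → Tm → Arity → Prop
  | atm {Φ : List Arity} {R : Atm} {α : Arity} : ArAtm Θ Φ R α → ArTm Θ Φ (.atm R) α
  | lam {Φ : List Arity} {M : Tm} {α β : Arity} :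
      ArTm Θ (α :: Φ) M β → ArTm Θ Φ (.lam M) (.arr α β)
/-- `ArAtm Θ Φ R α`: the atomic term `R` has arity type `α`. -/
inductive ArAtm (Θ : ArityCtx) : List Arity → Atm → Arity → Prop
  | const {Φ : List Arity} {c : TmConst} {α : Arity} :
      (Sym.const c, α) ∈ Θ → ArAtm Θ Φ (.const c) α
  | nom {Φ : List Arity} {n : Nom} {α : Arity} :
      (Sym.nom n, α) ∈ Θ → ArAtm Θ Φ (.nom n) α
  | var {Φ : List Arity} {x : Var} {α : Arity} :
      (Sym.var x, α) ∈ Θ → ArAtm Θ Φ (.var x) α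
  | bvar {Φ : List Arity} {i : ℕ} {α : Arity} : Φ[i]? = some α → ArAtm Θ Φ (.bvar i) α
  | app {Φ : List Arity} {R : Atm} {M : Tm} {α β : Arity} :
      ArAtm Θ Φ R (.arr α β) → ArTm Θ Φ M α → ArAtm Θ Φ (.app R M) β
end

/-- Arity kinding of atomic type families. Only the erasures of the domains of the kind `K`
matter, and these are not affected by substitution. -/
inductive ArFam (S : Signature) (Θ : ArityCtx) : List Arity → Fam → Kind → Prop
  | const {Φ : List Arity} {a : TyConst} {K : Kind} :
      Decl.ty a K ∈ S → ArFam S Θ Φ (.const a) K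
  | app {Φ : List Arity} {P : Fam} {M : Tm} {A : Ty} {K : Kind} :
      ArFam S Θ Φ P (.pi A K) → ArTm Θ Φ M A.erase → ArFam S Θ Φ (.app P M) K

/-- Arity kinding of types. -/
inductive ArTy (S : Signature) (Θ : ArityCtx) : List Arity → Ty → Prop
  | fam {Φ : List Arity} {P : Fam} : ArFam S Θ Φ P .type → ArTy S Θ Φ (.fam P)
  | pi {Φ : List Arity} {A B : Ty} :
      ArTy S Θ Φ A → ArTy S Θ (A.erase :: Φ) B → ArTy S Θ Φ (.pi A B)

/-! ### Context schemas -/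

/-- Block schemas `{x₁:α₁, …, xₙ:αₙ} y₁:A₁, …, yₘ:Aₘ`. -/
structure BlockSchema : Type where
  params : List (Var × Arity)
  decls : Bindings Var

/-- Context schemas, latest block schema first. -/
abbrev CtxSchema := List BlockSchema

/-- `DeclsWf S Θ D Θ'`: the block declaration `D` is well-formed over `Θ`, which it extends
to `Θ'`. -/
inductive DeclsWf (S : Signature) (Θ : ArityCtx) : Bindings Var → ArityCtx → Prop
  | nil : DeclsWf S Θ [] Θ
  | cons {D : Bindings Var} {Θ' : ArityCtx} {y : Var} {A : Ty} :
      DeclsWf S Θ D Θ' → (∀ α, (Sym.var y, α) ∉ Θ') → ArTy S Θ' [] A →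
      DeclsWf S Θ ((y, A) :: D) (Θ' ∪ {(Sym.var y, A.erase)})

/-- Well-formed block schemas. -/
def BlockSchema.Wf (S : Signature) (B : BlockSchema) : Prop :=
  (B.params.map Prod.fst).Nodup ∧
  ∃ Θ', DeclsWf S (S.arityCtx ∪ paramCtx B.params) B.decls Θ'

/-- Well-formed context schemas. -/
inductive SchemaWf (S : Signature) : CtxSchema → Prop
  | nil : SchemaWf S []
  | cons {C : CtxSchema} {B : BlockSchema} : SchemaWf S C → B.Wf S → SchemaWf S (B :: C)

/-- `DeclInst D G θ`: the context expression `G` results from the block declaration `D` by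
replacing the declared variables by nominal constants, as recorded in `θ`. -/
inductive DeclInst : Bindings Var → Ctx → Subst → Prop
  | nil : DeclInst [] [] []
  | cons {D : Bindings Var} {G : Ctx} {θ : Subst} {y : Var} {A A' : Ty} {n : Nom} :
      DeclInst D G θ → n.arity = A.erase → SubTy (Env.ofSubst θ) A A' →
      DeclInst ((y, A) :: D) ((n, A') :: G) ((y, .atm (.nom n), A.erase) :: θ)

/-- Application of a substitution to the types in a closed context expression. -/
inductive SubCtx (θ : Subst) : Ctx → Ctx → Prop
  | nil : SubCtx θ [] []
  | cons {G G' : Ctx} {n : Nom} {A A' : Ty} :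
      SubCtx θ G G' → SubTy (Env.ofSubst θ) A A' → SubCtx θ ((n, A) :: G) ((n, A') :: G')

/-- `ParamSubst S xs ρ`: `ρ` replaces each parameter `x : α` in `xs` by a closed term of arity
type `α`. -/
inductive ParamSubst (S : Signature) : List (Var × Arity) → Subst → Prop
  | nil : ParamSubst S [] []
  | cons {xs : List (Var × Arity)} {ρ : Subst} {x : Var} {α : Arity} {t : Tm} :
      ParamSubst S xs ρ → ArTm (nomCtx ∪ S.arityCtx) [] t α →
      ParamSubst S ((x, α) :: xs) ((x, t, α) :: ρ)

/-- `BlockInst S B G`: the context expression `G` is an instance of the block schema `B`. -/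
inductive BlockInst (S : Signature) : BlockSchema → Ctx → Prop
  | mk {B : BlockSchema} {G₀ G : Ctx} {θ ρ : Subst} :
      DeclInst B.decls G₀ θ → ParamSubst S B.params ρ → SubCtx ρ G₀ G → BlockInst S B G

/-- `SchemaInstOne S C G`: `G` is an instance of one of the block schemas in `C`. -/
inductive SchemaInstOne (S : Signature) : CtxSchema → Ctx → Prop
  | here {C : CtxSchema} {B : BlockSchema} {G : Ctx} :
      BlockInst S B G → SchemaInstOne S (B :: C) G
  | there {C : CtxSchema} {B : BlockSchema} {G : Ctx} :
      SchemaInstOne S C G → SchemaInstOne S (B :: C) G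

/-- `SchemaInst S C G`: the context expression `G` is an instance of the context schema `C`. -/
inductive SchemaInst (S : Signature) : CtxSchema → Ctx → Prop
  | nil {C : CtxSchema} : SchemaInst S C []
  | append {C : CtxSchema} {G G₁ : Ctx} :
      SchemaInst S C G → SchemaInstOne S C G₁ → SchemaInst S C (G₁ ++ G)

/-! ### Formulas -/

/-- Context expressions `G ::= Γ | · | G, n:A`. -/
structure CtxExpr : Type where
  root : Option CtxVar
  binds : Bindings Nom

/-- The formulas of the logic. -/
inductive Formula : Type
  | atom : CtxExpr → Tm → Ty → Formula
  | top : Formula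
  | bot : Formula
  | imp : Formula → Formula → Formula
  | and : Formula → Formula → Formula
  | or : Formula → Formula → Formula
  | all : Var → Arity → Formula → Formula
  | ex : Var → Arity → Formula → Formula
  | ctxAll : CtxVar → CtxSchema → Formula → Formula

/-- `FmlSubord S Γ A F`: the type `A` is subordinate to the formula `F` relative to the context
variable `Γ`. -/
inductive FmlSubord (S : Signature) (Γ : CtxVar) (A : Ty) : Formula → Prop
  | ctxAll {Γ' : CtxVar} {C : CtxSchema} {F : Formula} :
      Γ ≠ Γ' → FmlSubord S Γ A F → FmlSubord S Γ A (.ctxAll Γ' C F)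
  | all {x : Var} {α : Arity} {F : Formula} :
      FmlSubord S Γ A F → FmlSubord S Γ A (.all x α F)
  | ex {x : Var} {α : Arity} {F : Formula} :
      FmlSubord S Γ A F → FmlSubord S Γ A (.ex x α F)
  | impLeft {F₁ F₂ : Formula} : FmlSubord S Γ A F₁ → FmlSubord S Γ A (.imp F₁ F₂)
  | impRight {F₁ F₂ : Formula} : FmlSubord S Γ A F₂ → FmlSubord S Γ A (.imp F₁ F₂)
  | andLeft {F₁ F₂ : Formula} : FmlSubord S Γ A F₁ → FmlSubord S Γ A (.and F₁ F₂)
  | andRight {F₁ F₂ : Formula} : FmlSubord S Γ A F₂ → FmlSubord S Γ A (.and F₁ F₂)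
  | orLeft {F₁ F₂ : Formula} : FmlSubord S Γ A F₁ → FmlSubord S Γ A (.or F₁ F₂)
  | orRight {F₁ F₂ : Formula} : FmlSubord S Γ A F₂ → FmlSubord S Γ A (.or F₁ F₂)
  | atomVar {M : Tm} {A' : Ty} :
      TySubord S A A' → FmlSubord S Γ A (.atom ⟨some Γ, []⟩ M A')
  | atomExplicit {b : Nom × Ty} {G : Bindings Nom} {M : Tm} {A' : Ty} :
      FmlSubord S Γ A (.atom ⟨some Γ, b :: G⟩ M A')

/-! ### Subsumption and pruning -/

/-- `CtxSubsumes S Γ F G G'`: `G` subsumes `G'` relative to the context variable `Γ` and the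
formula `F`. The definition covers context expressions and block declarations. -/
inductive CtxSubsumes (S : Signature) (Γ : CtxVar) (F : Formula) {ι : Type} :
    Bindings ι → Bindings ι → Prop
  | nil : CtxSubsumes S Γ F [] []
  | keep {G G' : Bindings ι} {n : ι} {A : Ty} :
      CtxSubsumes S Γ F G G' → CtxSubsumes S Γ F ((n, A) :: G) ((n, A) :: G')
  | drop {G G' : Bindings ι} {n : ι} {A : Ty} :
      CtxSubsumes S Γ F G G' → ¬ FmlSubord S Γ A F → CtxSubsumes S Γ F G ((n, A) :: G')

/-- `Prunes S C G G'`: `G` results from `G'` by dropping bindings whose types are not subordinate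
to any type assigned in a block schema of `C`. The definition covers context expressions and
block declarations. -/
inductive Prunes (S : Signature) (C : CtxSchema) {ι : Type} :
    Bindings ι → Bindings ι → Prop
  | nil : Prunes S C [] []
  | keep {G G' : Bindings ι} {n : ι} {A : Ty} :
      Prunes S C G G' → Prunes S C ((n, A) :: G) ((n, A) :: G')
  | drop {G G' : Bindings ι} {n : ι} {A : Ty} :
      Prunes S C G G' → (∀ B ∈ C, ∀ b ∈ B.decls, ¬ TySubord S A b.2) →
      Prunes S C G ((n, A) :: G')

/-- The result of applying a renaming of variables to a block schema. -/
def BlockSchema.rename (p : Var → Var) (B : BlockSchema) : BlockSchema where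
  params := B.params.map fun q => (p q.1, q.2)
  decls := B.decls.map fun b => (p b.1, b.2.rename p)

/-- `B'` is a variant of `B`: it results from `B` by a permutation of the variables that moves
only finitely many of them. -/
def IsVariant (B' B : BlockSchema) : Prop :=
  ∃ p : Equiv.Perm Var, {x | p x ≠ x}.Finite ∧ B' = B.rename p

/-- The arity types that a block schema gives to its parameters and to the variables that
it declares. -/
def BlockSchema.arityCtx (B : BlockSchema) : ArityCtx :=
  paramCtx B.params ∪ {e | ∃ b ∈ B.decls, e = (Sym.var b.1, b.2.erase)}

/-- The names in two block schemas are aligned: a variable that occurs in the arity contexts of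
both has the same arity type in both. -/
def Aligned (B B' : BlockSchema) : Prop :=
  ∀ x α α', (Sym.var x, α) ∈ B.arityCtx → (Sym.var x, α') ∈ B'.arityCtx → α = α'

/-- `BlockMatch S Γ F C B' D`: the block schema `B'` is matched by one of the block schemas in
`D`, relative to `F` and `Γ`, with pruning relative to the context schema `C`. -/
inductive BlockMatch (S : Signature) (Γ : CtxVar) (F : Formula) (C : CtxSchema)
    (B' : BlockSchema) : CtxSchema → Prop
  | here {D : CtxSchema} {B : BlockSchema} :
      Aligned B B' → Prunes S C B.decls B'.decls → CtxSubsumes S Γ F B.decls B'.decls →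
      BlockMatch S Γ F C B' (B :: D)
  | there {D : CtxSchema} {B : BlockSchema} :
      BlockMatch S Γ F C B' D → BlockMatch S Γ F C B' (B :: D)

/-- `SchemaSubsumes S Γ F C C'`: the context schema `C` subsumes the context schema `C'` relative
to the formula `F` and the context variable `Γ`. -/
inductive SchemaSubsumes (S : Signature) (Γ : CtxVar) (F : Formula) (C : CtxSchema) :
    CtxSchema → Prop
  | nil : SchemaSubsumes S Γ F C []
  | cons {C' : CtxSchema} {B B' : BlockSchema} :
      SchemaSubsumes S Γ F C C' → IsVariant B' B → BlockMatch S Γ F C B' C →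
      SchemaSubsumes S Γ F C (B :: C')

end LLF

/-!
An instance `G'` of `C'` is cut down to an instance of `C` one block at a time, and the context that
remains is well-formed by strengthening.

*Blocks.* Consider an instance of a block schema `B'` of `C'`, whose variant is matched by `B`.
Since the declared variables are replaced by nominal constants, which do not create redexes, the
two successive substitutions amount to a single valuation of all the variables of `B'` by closed
terms (`BlockInst.exists_val`). The parameters of `B` need not be those of `B'`. A parameter of `B`
that `B'` has as a parameter or as a declared variable receives the value it has there, which fits
because the names are aligned; any other parameter receives a nominal constant of its arity type
(`ParamSubst.exists_compatible`). A type of `B` is also a type of the variant of `B'`, so that its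
free variables are in scope in both, and the two valuations give it the same instance
(`SubTy.rename`). The valuation for `B` is decomposed again into the two substitutions
(`SubTy.split`), so that the bindings that come from `B` form an instance of it
(`exists_declInst`). The declared variables are distinct, hence subsumption and pruning drop the
same bindings (`Drops.of_prunes_of_subsumes`). Whether a binding may be dropped depends only on the
head of its type, and this head is invariant under substitution.

*Well-formedness.* The types kept have heads that occur in `C`, so the types dropped are not
subordinate to any of them. If all the types in sight respect subordination, then in a derivation
of `G ⊢ A type` or `G ⊢ M : A` only bindings whose types are subordinate to `A` are used: the
head of a term of type `A` has a type with the same head as `A`, and its arguments have types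
subordinate to `A`. The other bindings may therefore be removed (`Check.strengthen`,
`TyWf.strengthen`, `CtxWf.drops`).
-/

namespace LLF

/-! ### Heads and subordination under substitution -/

theorem SubFam.head_eq {ε : Env} {P P' : Fam} (h : SubFam ε P P') : P'.head = P.head := by
  induction h with
  | const => rfl
  | app _ _ ih => exact ih

theorem SubTy.head_eq {ε : Env} {A A' : Ty} (h : SubTy ε A A') : A'.head = A.head := by
  induction h with
  | fam h => exact h.head_eq
  | pi _ _ _ ih => exact ih

theorem SubTy.respects {S : Signature} {ε : Env} {A A' : Ty} (h : SubTy ε A A')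
    (hA : A.Respects S) : A'.Respects S := by
  induction h with
  | fam _ => trivial
  | pi hA' hB' ihA ihB =>
    refine ⟨?_, ihA hA.2.1, ihB hA.2.2⟩
    simpa only [TySubord, hA'.head_eq, hB'.head_eq] using hA.1

/-- The domains of a kind are changed by a substitution, but each keeps its head, and respect for
subordination is inherited from the original domain. -/
theorem SubKind.exists_dom {S : Signature} {ε : Env} {K K' : Kind} (h : SubKind ε K K') :
    ∀ A' ∈ K'.doms, ∃ A ∈ K.doms, A'.head = A.head ∧ (A.Respects S → A'.Respects S) := by
  induction h with
  | type => simp [Kind.doms]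
  | pi hA _ ih =>
    intro B hB
    rcases List.mem_cons.1 hB with rfl | hB
    · exact ⟨_, List.mem_cons_self, hA.head_eq, hA.respects⟩
    · obtain ⟨B₀, h₀, h₁⟩ := ih B hB
      exact ⟨B₀, List.mem_cons_of_mem _ h₀, h₁⟩

theorem Fam.head_openNom (n : Nom) (k : ℕ) (P : Fam) : (P.openNom n k).head = P.head := by
  induction P with
  | const => rfl
  | app _ _ ih => exact ih

theorem Ty.head_openNom (n : Nom) (A : Ty) : ∀ k, (A.openNom n k).head = A.head := by
  induction A with
  | fam P => exact fun k => P.head_openNom n k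
  | pi _ _ _ ih => exact fun k => ih (k + 1)

theorem Ty.Respects.openNom {S : Signature} (n : Nom) {A : Ty} (h : A.Respects S) :
    ∀ k, (A.openNom n k).Respects S := by
  induction A with
  | fam P => exact fun _ => trivial
  | pi A B ihA ihB =>
    intro k
    refine ⟨?_, ihA h.2.1 k, ihB h.2.2 (k + 1)⟩
    simpa only [TySubord, Ty.head_openNom] using h.1

theorem Fam.head_rename (p : Var → Var) (P : Fam) : (P.rename p).head = P.head := by
  induction P with
  | const => rfl
  | app _ _ ih => exact ih

theorem Ty.head_rename (p : Var → Var) (A : Ty) : (A.rename p).head = A.head := by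
  induction A with
  | fam P => exact P.head_rename p
  | pi _ _ _ ih => exact ih

theorem Ty.erase_rename (p : Var → Var) (A : Ty) : (A.rename p).erase = A.erase := by
  induction A with
  | fam P => rfl
  | pi _ _ ihA ihB => simp only [Ty.rename, Ty.erase, ihA, ihB]

theorem FmlSubord.congr_head {S : Signature} {Γ : CtxVar} {A B : Ty} {F : Formula}
    (hAB : A.head = B.head) (h : FmlSubord S Γ A F) : FmlSubord S Γ B F := by
  induction h with
  | ctxAll hne _ ih => exact .ctxAll hne ih
  | all _ ih => exact .all ih
  | ex _ ih => exact .ex ih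
  | impLeft _ ih => exact .impLeft ih
  | impRight _ ih => exact .impRight ih
  | andLeft _ ih => exact .andLeft ih
  | andRight _ ih => exact .andRight ih
  | orLeft _ ih => exact .orLeft ih
  | orRight _ ih => exact .orRight ih
  | atomVar h => exact .atomVar (by simpa only [TySubord, hAB] using h)
  | atomExplicit => exact .atomExplicit

/-! ### Strengthening -/

/-- `Strengthens S a G H`: the context `H` consists of bindings of `G`, and the types of the
missing bindings are not subordinate to the type constant `a`. That their heads are declared in
the signature is expressed by reflexivity, which `Subord` grants to declared constants only. -/
structure Strengthens (S : Signature) (a : TyConst) (G H : Ctx) : Prop where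
  subset : H ⊆ G
  dropped : ∀ b ∈ G, b ∈ H ∨ Subord S b.2.head b.2.head ∧ ¬ Subord S b.2.head a

namespace Strengthens

variable {S : Signature} {a b : TyConst} {G H : Ctx}

theorem mono (h : Strengthens S a G H) (hba : Subord S b a) : Strengthens S b G H :=
  ⟨h.subset, fun c hc => (h.dropped c hc).imp_right fun hd => ⟨hd.1, fun hcb => hd.2 (hcb.trans hba)⟩⟩

theorem cons (h : Strengthens S a G H) (c : Nom × Ty) : Strengthens S a (c :: G) (c :: H) := by
  refine ⟨List.cons_subset_cons c h.subset, fun d hd => ?_⟩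
  rcases List.mem_cons.1 hd with rfl | hd
  · exact .inl List.mem_cons_self
  · exact (h.dropped d hd).imp_left (List.mem_cons_of_mem _)

theorem notMem (h : Strengthens S a G H) {n : Nom} (hn : n ∉ G.map Prod.fst) :
    n ∉ H.map Prod.fst :=
  fun hH => hn (List.map_subset _ h.subset hH)

end Strengthens

theorem Ctx.Respects.cons {S : Signature} {G : Ctx} {n : Nom} {A : Ty} (hG : Ctx.Respects S G)
    (hA : A.Respects S) : Ctx.Respects S ((n, A) :: G) :=
  List.forall_mem_cons.2 ⟨hA, hG⟩

theorem Synth.respects {S : Signature} (hS : S.Respects) {G : Ctx} {R : Atm} {A : Ty}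
    (hG : G.Respects S) : Synth S G R A → A.Respects S
  | .const h => hS.1 _ _ h
  | .nom h => hG _ h
  | .app h _ hs => hs.respects (Synth.respects hS hG h).2.2

mutual
/-- Strengthening for canonical terms. A nominal constant at the head of a term of type `A` has a
type with the head of `A`, and the types of its arguments are subordinate to `A`, so only bindings
whose types are subordinate to `A` are ever used. -/
theorem Check.strengthen {S : Signature} (hS : S.Respects) {G H : Ctx} {M : Tm} {A : Ty}
    (h : Check S G M A) (hG : G.Respects S) (hA : A.Respects S)
    (hH : Strengthens S A.head G H) : Check S H M A :=
  match h with
  | .atm h => .atm (Synth.strengthen hS h hG hH)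
  | .lam n hn hnG hM hB h =>
    .lam n hn (hH.notMem hnG) hM hB
      (Check.strengthen hS h (hG.cons hA.2.1) (hA.2.2.openNom n 0)
        (by rw [Ty.head_openNom]; exact hH.cons _))
/-- Strengthening for atomic terms. -/
theorem Synth.strengthen {S : Signature} (hS : S.Respects) {G H : Ctx} {R : Atm} {A : Ty}
    (h : Synth S G R A) (hG : G.Respects S)
    (hH : Strengthens S A.head G H) : Synth S H R A :=
  match h with
  | .const h => .const h
  | .nom h => .nom ((hH.dropped _ h).resolve_right fun hd => hd.2 hd.1)
  | .app hR hM hs =>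
    have hA := hR.respects hS hG
    have hH' : Strengthens S _ G H := hs.head_eq ▸ hH
    .app (Synth.strengthen hS hR hG hH') (Check.strengthen hS hM hG hA.2.1 (hH'.mono hA.1)) hs
end

theorem SynthKind.dom_subord {S : Signature} (hS : S.Respects) {G : Ctx} {P : Fam} {K : Kind}
    (h : SynthKind S G P K) : ∀ A ∈ K.doms, Subord S A.head P.head ∧ A.Respects S := by
  induction h with
  | const h => exact fun A hA => ⟨.indexTy h hA, hS.2 _ _ h A hA⟩
  | app _ _ hs ih =>
    intro A hA
    obtain ⟨A₀, hA₀, hhd, hr⟩ := hs.exists_dom (S := S) A hA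
    obtain ⟨h₁, h₂⟩ := ih A₀ (List.mem_cons_of_mem _ hA₀)
    exact ⟨hhd ▸ h₁, hr h₂⟩

theorem SynthKind.strengthen {S : Signature} (hS : S.Respects) {G H : Ctx} {P : Fam} {K : Kind}
    (h : SynthKind S G P K) (hG : G.Respects S) (hH : Strengthens S P.head G H) :
    SynthKind S H P K := by
  induction h with
  | const h => exact .const h
  | app hP hM hs ih =>
    obtain ⟨h₁, h₂⟩ := hP.dom_subord hS _ List.mem_cons_self
    exact .app (ih hH) (hM.strengthen hS hG h₂ (hH.mono h₁)) hs

theorem TyWf.strengthen {S : Signature} (hS : S.Respects) {G : Ctx} {A : Ty}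
    (h : TyWf S G A) : ∀ {H : Ctx}, G.Respects S → A.Respects S → Strengthens S A.head G H →
    TyWf S H A := by
  induction h with
  | fam h => exact fun hG _ hH => .fam (h.strengthen hS hG hH)
  | pi n _ hn hnG hB _ ihA ihB =>
    intro H hG hA hH
    refine .pi n (ihA hG hA.2.1 (hH.mono hA.1)) hn (hH.notMem hnG) hB
      (ihB (hG.cons hA.2.1) (hA.2.2.openNom n 0) ?_)
    rw [Ty.head_openNom]
    exact hH.cons _

theorem SynthKind.subord_refl {S : Signature} {G : Ctx} {P : Fam} {K : Kind}
    (h : SynthKind S G P K) : Subord S P.head P.head := by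
  induction h with
  | const h => exact .refl h
  | app _ _ _ ih => exact ih

theorem TyWf.subord_refl {S : Signature} {G : Ctx} {A : Ty} (h : TyWf S G A) :
    Subord S A.head A.head := by
  induction h with
  | fam h => exact h.subord_refl
  | pi n _ _ _ _ _ _ ih => rwa [Ty.head_openNom] at ih

theorem CtxWf.subord_refl {S : Signature} {G : Ctx} (h : CtxWf S G) :
    ∀ b ∈ G, Subord S b.2.head b.2.head := by
  induction h with
  | nil => simp
  | cons _ _ _ hA ih => exact List.forall_mem_cons.2 ⟨hA.subord_refl, ih⟩

/-! ### Hereditary substitution of nominal constants -/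

/-- The environment replaces named variables by nominal constants only, and keeps the bound
variables. -/
structure Env.IsNominal (η : Env) : Prop where
  nm : ∀ x M α, η.nm x = some (M, α) → ∃ n, M = .atm (.nom n)
  ix : ∀ i, η.ix i = .inr i

/-- The environment that acts as `η`, and as `ρ` where `η` does nothing; for a nominal `η`, this
is the composite of the two. -/
def Env.comp (η ρ : Env) : Env where
  nm x := (η.nm x).or (ρ.nm x)
  ix := ρ.ix

theorem Env.IsNominal.up {η : Env} (h : η.IsNominal) : η.up.IsNominal where
  nm x M α hx := by
    obtain ⟨⟨M₀, α₀⟩, h₀, h₁⟩ := Option.map_eq_some_iff.1 hx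
    obtain ⟨n, rfl⟩ := h.nm x _ _ h₀
    exact ⟨n, (congrArg Prod.fst h₁).symm⟩
  ix i := by
    cases i with
    | zero => rfl
    | succ j => simp [Env.up, h.ix j]

theorem Env.comp_up (η ρ : Env) : (η.comp ρ).up = η.up.comp ρ.up := by
  simp only [Env.comp, Env.up, Env.mk.injEq, and_true]
  funext x
  cases η.nm x <;> rfl

theorem SubAtm.eq_atm {ε : Env} {R : Atm} {M : Tm} (h : SubAtm ε R M none) :
    ∃ R', M = .atm R' := by
  cases h <;> exact ⟨_, rfl⟩

mutual
theorem SubTm.comp {η ρ : Env} {M M₁ M₂ : Tm} (hη : η.IsNominal)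
    (h : SubTm η M M₁) (h₂ : SubTm ρ M₁ M₂) : SubTm (η.comp ρ) M M₂ :=
  match h with
  | .atm h => by
    obtain ⟨R₁, rfl, hc⟩ := SubAtm.comp (ρ := ρ) hη h
    cases h₂ with
    | atm h₂ =>
      rcases hc _ _ h₂ with ⟨_, hc⟩ | ⟨_, _, hc⟩
      · exact .atm hc
      · exact .atm hc
  | .lam h => by
    cases h₂ with
    | lam h₂ =>
      exact .lam (Env.comp_up η ρ ▸ SubTm.comp hη.up h h₂)
/-- At most one of the two substitutions replaces the head of an atomic term, as a nominal
constant is not replaced any more. -/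
theorem SubAtm.comp {η ρ : Env} {R : Atm} {M : Tm} {r : Option Arity} (hη : η.IsNominal)
    (h : SubAtm η R M r) : ∃ R₁, M = .atm R₁ ∧ ∀ M₂ r₂, SubAtm ρ R₁ M₂ r₂ →
      (r = none ∧ SubAtm (η.comp ρ) R M₂ r₂) ∨ (r ≠ none ∧ r₂ = none ∧ SubAtm (η.comp ρ) R M₂ r) :=
  match h with
  | .const => ⟨_, rfl, fun _ _ h₂ => by cases h₂; exact .inl ⟨rfl, .const⟩⟩
  | .nom => ⟨_, rfl, fun _ _ h₂ => by cases h₂; exact .inl ⟨rfl, .nom⟩⟩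
  | .varKeep hx => ⟨_, rfl, fun _ _ h₂ => by
      cases h₂ with
      | varKeep h₂ => exact .inl ⟨rfl, .varKeep (by simp [Env.comp, hx, h₂])⟩
      | varRepl h₂ => exact .inl ⟨rfl, .varRepl (by simp [Env.comp, hx, h₂])⟩⟩
  | .varRepl hx => by
      obtain ⟨n, rfl⟩ := hη.nm _ _ _ hx
      refine ⟨_, rfl, fun _ _ h₂ => ?_⟩
      cases h₂
      exact .inr ⟨by simp, rfl, .varRepl (by simp [Env.comp, hx])⟩
  | .bvarKeep hi => by
      refine ⟨_, rfl, fun _ _ h₂ => ?_⟩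
      obtain rfl := Sum.inr.inj ((hη.ix _).symm.trans hi)
      cases h₂ with
      | bvarKeep h₂ => exact .inl ⟨rfl, .bvarKeep h₂⟩
      | bvarRepl h₂ => exact .inl ⟨rfl, .bvarRepl h₂⟩
  | .bvarRepl hi => by simp [hη.ix] at hi
  | .appKeep hR hM => by
      obtain ⟨R₁, hR₁, hc⟩ := SubAtm.comp (ρ := ρ) hη hR
      cases hR₁
      refine ⟨_, rfl, fun _ _ h₂ => ?_⟩
      cases h₂ with
      | appKeep h₂ hM₂ =>
        rcases hc _ _ h₂ with ⟨_, hc⟩ | ⟨hn, _⟩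
        · exact .inl ⟨rfl, .appKeep hc (SubTm.comp hη hM hM₂)⟩
        · exact absurd rfl hn
      | appAtm h₂ hM₂ =>
        rcases hc _ _ h₂ with ⟨_, hc⟩ | ⟨hn, _⟩
        · exact .inl ⟨rfl, .appAtm hc (SubTm.comp hη hM hM₂)⟩
        · exact absurd rfl hn
      | appLam h₂ hM₂ hN =>
        rcases hc _ _ h₂ with ⟨_, hc⟩ | ⟨hn, _⟩
        · exact .inl ⟨rfl, .appLam hc (SubTm.comp hη hM hM₂) hN⟩
        · exact absurd rfl hn
  | .appAtm hR hM => by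
      obtain ⟨R₁, hR₁, hc⟩ := SubAtm.comp (ρ := ρ) hη hR
      cases hR₁
      refine ⟨_, rfl, fun _ _ h₂ => ?_⟩
      cases h₂ with
      | appKeep h₂ hM₂ =>
        rcases hc _ _ h₂ with ⟨hn, _⟩ | ⟨_, _, hc⟩
        · exact absurd hn (by simp)
        · exact .inr ⟨by simp, rfl, .appAtm hc (SubTm.comp hη hM hM₂)⟩
      | appAtm h₂ _ => rcases hc _ _ h₂ with ⟨hn, _⟩ | ⟨_, hn, _⟩ <;> simp at hn
      | appLam h₂ _ _ => rcases hc _ _ h₂ with ⟨hn, _⟩ | ⟨_, hn, _⟩ <;> simp at hn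
  | .appLam hR _ _ => by
      obtain ⟨R₁, hR₁, -⟩ := SubAtm.comp (ρ := ρ) hη hR
      cases hR₁
end

theorem SubFam.comp {η ρ : Env} {P P₁ P₂ : Fam} (hη : η.IsNominal)
    (h : SubFam η P P₁) (h₂ : SubFam ρ P₁ P₂) : SubFam (η.comp ρ) P P₂ := by
  induction h generalizing P₂ with
  | const => cases h₂; exact .const
  | app _ hM ih =>
    cases h₂ with
    | app h₂ hM₂ => exact .app (ih h₂) (hM.comp hη hM₂)

theorem SubTy.comp {η ρ : Env} {A A₁ A₂ : Ty} (hη : η.IsNominal)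
    (h : SubTy η A A₁) (h₂ : SubTy ρ A₁ A₂) : SubTy (η.comp ρ) A A₂ := by
  induction h generalizing ρ A₂ with
  | fam h =>
    cases h₂ with
    | fam h₂ => exact .fam (h.comp hη h₂)
  | pi _ _ ihA ihB =>
    cases h₂ with
    | pi h₂ h₂' => exact .pi (ihA hη h₂) (Env.comp_up _ _ ▸ ihB hη.up h₂')

mutual
theorem SubTm.split {η ρ : Env} {M M₂ : Tm} {ε : Env} (hη : η.IsNominal)
    (h : SubTm ε M M₂) (hε : ε = η.comp ρ) : ∃ M₁, SubTm η M M₁ ∧ SubTm ρ M₁ M₂ :=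
  match h with
  | .atm h => by
    obtain ⟨R₁, r₁, r₂, h₁, h₂, -⟩ := SubAtm.split (ρ := ρ) hη h hε
    exact ⟨_, .atm h₁, .atm h₂⟩
  | .lam h => by
    obtain ⟨M₁, h₁, h₂⟩ := SubTm.split (ρ := ρ.up) hη.up h (by rw [hε, Env.comp_up])
    exact ⟨_, .lam h₁, .lam h₂⟩
theorem SubAtm.split {η ρ : Env} {R : Atm} {M₂ : Tm} {r : Option Arity} {ε : Env}
    (hη : η.IsNominal) (h : SubAtm ε R M₂ r) (hε : ε = η.comp ρ) :
    ∃ R₁ r₁ r₂, SubAtm η R (.atm R₁) r₁ ∧ SubAtm ρ R₁ M₂ r₂ ∧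
      (r₁ = none ∧ r₂ = r ∨ r₁ = r ∧ r₂ = none) :=
  match h with
  | .const => ⟨_, _, _, .const, .const, .inl ⟨rfl, rfl⟩⟩
  | .nom => ⟨_, _, _, .nom, .nom, .inl ⟨rfl, rfl⟩⟩
  | .varKeep hx => by
    subst hε
    obtain ⟨h₁, h₂⟩ := Option.or_eq_none_iff.1 hx
    exact ⟨_, _, _, .varKeep h₁, .varKeep h₂, .inl ⟨rfl, rfl⟩⟩
  | .varRepl hx => by
    subst hε
    rcases Option.or_eq_some_iff.1 hx with h₁ | ⟨h₁, h₂⟩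
    · obtain ⟨n, rfl⟩ := hη.nm _ _ _ h₁
      exact ⟨_, _, _, .varRepl h₁, .nom, .inr ⟨rfl, rfl⟩⟩
    · exact ⟨_, _, _, .varKeep h₁, .varRepl h₂, .inl ⟨rfl, rfl⟩⟩
  | .bvarKeep hi => by
    subst hε
    exact ⟨_, _, _, .bvarKeep (hη.ix _), .bvarKeep hi, .inl ⟨rfl, rfl⟩⟩
  | .bvarRepl hi => by
    subst hε
    exact ⟨_, _, _, .bvarKeep (hη.ix _), .bvarRepl hi, .inl ⟨rfl, rfl⟩⟩
  | .appKeep hR hM => by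
    obtain ⟨R₁, r₁, r₂, h₁, h₂, hr⟩ := SubAtm.split (ρ := ρ) hη hR hε
    obtain ⟨M₁, hM₁, hM₂⟩ := SubTm.split (ρ := ρ) hη hM hε
    obtain ⟨rfl, rfl⟩ : r₁ = none ∧ r₂ = none := by tauto
    exact ⟨_, _, _, .appKeep h₁ hM₁, .appKeep h₂ hM₂, .inl ⟨rfl, rfl⟩⟩
  | .appAtm hR hM => by
    obtain ⟨R₁, r₁, r₂, h₁, h₂, ⟨rfl, rfl⟩ | ⟨rfl, rfl⟩⟩ := SubAtm.split (ρ := ρ) hη hR hε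
    all_goals obtain ⟨M₁, hM₁, hM₂⟩ := SubTm.split (ρ := ρ) hη hM hε
    · exact ⟨_, _, _, .appKeep h₁ hM₁, .appAtm h₂ hM₂, .inl ⟨rfl, rfl⟩⟩
    · exact ⟨_, _, _, .appAtm h₁ hM₁, .appKeep h₂ hM₂, .inr ⟨rfl, rfl⟩⟩
  | .appLam hR hM hN => by
    obtain ⟨R₁, r₁, r₂, h₁, h₂, ⟨rfl, rfl⟩ | ⟨rfl, rfl⟩⟩ := SubAtm.split (ρ := ρ) hη hR hε
    · obtain ⟨M₁, hM₁, hM₂⟩ := SubTm.split (ρ := ρ) hη hM hε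
      exact ⟨_, _, _, .appKeep h₁ hM₁, .appLam h₂ hM₂ hN, .inl ⟨rfl, rfl⟩⟩
    · obtain ⟨_, h⟩ := h₂.eq_atm
      cases h
end

theorem SubFam.split {η ρ : Env} {P P₂ : Fam} (hη : η.IsNominal)
    (h : SubFam (η.comp ρ) P P₂) : ∃ P₁, SubFam η P P₁ ∧ SubFam ρ P₁ P₂ := by
  induction P generalizing P₂ with
  | const => cases h; exact ⟨_, .const, .const⟩
  | app _ _ ih =>
    cases h with
    | app h hM =>
      obtain ⟨P₁, h₁, h₂⟩ := ih h
      obtain ⟨M₁, hM₁, hM₂⟩ := hM.split hη rfl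
      exact ⟨_, .app h₁ hM₁, .app h₂ hM₂⟩

/-- The substitution `η.comp ρ` can be carried out in two steps. -/
theorem SubTy.split {η ρ : Env} {A A₂ : Ty} (hη : η.IsNominal)
    (h : SubTy (η.comp ρ) A A₂) : ∃ A₁, SubTy η A A₁ ∧ SubTy ρ A₁ A₂ := by
  generalize hε : η.comp ρ = ε at h
  induction h generalizing η ρ with
  | fam h =>
    subst hε
    obtain ⟨P₁, h₁, h₂⟩ := h.split hη
    exact ⟨_, .fam h₁, .fam h₂⟩
  | pi _ _ ihA ihB =>
    obtain ⟨A₁, hA₁, hA₂⟩ := ihA hη hε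
    obtain ⟨B₁, hB₁, hB₂⟩ := ihB hη.up (by rw [← Env.comp_up, hε])
    exact ⟨_, .pi hA₁ hB₁, .pi hA₂ hB₂⟩

/-! ### Free variables -/

mutual
/-- The variable `x` occurs free in the term. -/
def Tm.Occurs (x : Var) : Tm → Prop
  | .atm R => R.Occurs x
  | .lam M => M.Occurs x
/-- The variable `x` occurs free in the atomic term. -/
def Atm.Occurs (x : Var) : Atm → Prop
  | .const _ => False
  | .var y => y = x
  | .nom _ => False
  | .bvar _ => False
  | .app R M => R.Occurs x ∨ M.Occurs x
end

/-- The variable `x` occurs free in the family. -/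
def Fam.Occurs (x : Var) : Fam → Prop
  | .const _ => False
  | .app P M => P.Occurs x ∨ M.Occurs x

/-- The variable `x` occurs free in the type. -/
def Ty.Occurs (x : Var) : Ty → Prop
  | .fam P => P.Occurs x
  | .pi A B => A.Occurs x ∨ B.Occurs x

mutual
theorem Tm.Occurs.rename (p : Var → Var) {x : Var} :
    ∀ {M : Tm}, M.Occurs x → (M.rename p).Occurs (p x)
  | .atm R => fun h => Atm.Occurs.rename p (R := R) h
  | .lam M => fun h => Tm.Occurs.rename p (M := M) h
theorem Atm.Occurs.rename (p : Var → Var) {x : Var} :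
    ∀ {R : Atm}, R.Occurs x → (R.rename p).Occurs (p x)
  | .const _ => False.elim
  | .var _ => congrArg p
  | .nom _ => False.elim
  | .bvar _ => False.elim
  | .app _ _ => Or.imp (Atm.Occurs.rename p) (Tm.Occurs.rename p)
end

theorem Fam.Occurs.rename (p : Var → Var) {x : Var} :
    ∀ {P : Fam}, P.Occurs x → (P.rename p).Occurs (p x)
  | .const _ => False.elim
  | .app _ _ => Or.imp (Fam.Occurs.rename p) (Tm.Occurs.rename p)

theorem Ty.Occurs.rename (p : Var → Var) {x : Var} :
    ∀ {A : Ty}, A.Occurs x → (A.rename p).Occurs (p x)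
  | .fam P => fun h => Fam.Occurs.rename p (P := P) h
  | .pi _ _ => Or.imp (Ty.Occurs.rename p) (Ty.Occurs.rename p)

mutual
theorem ArTm.exists_mem {Θ : ArityCtx} {Φ : List Arity} {M : Tm} {α : Arity} {x : Var} :
    ArTm Θ Φ M α → M.Occurs x → ∃ β, (Sym.var x, β) ∈ Θ
  | .atm h, hx => ArAtm.exists_mem h hx
  | .lam h, hx => ArTm.exists_mem h hx
theorem ArAtm.exists_mem {Θ : ArityCtx} {Φ : List Arity} {R : Atm} {α : Arity} {x : Var} :
    ArAtm Θ Φ R α → R.Occurs x → ∃ β, (Sym.var x, β) ∈ Θ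
  | .var h, hx => ⟨_, (show _ = x from hx) ▸ h⟩
  | .app h _, .inl hx => ArAtm.exists_mem h hx
  | .app _ h, .inr hx => ArTm.exists_mem h hx
end

theorem ArFam.exists_mem {S : Signature} {Θ : ArityCtx} {Φ : List Arity} {P : Fam} {K : Kind}
    {x : Var} (h : ArFam S Θ Φ P K) (hx : P.Occurs x) : ∃ β, (Sym.var x, β) ∈ Θ := by
  induction h with
  | const => exact hx.elim
  | app _ hM ih => exact hx.elim ih hM.exists_mem

theorem ArTy.exists_mem {S : Signature} {Θ : ArityCtx} {Φ : List Arity} {A : Ty}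
    {x : Var} (h : ArTy S Θ Φ A) (hx : A.Occurs x) : ∃ β, (Sym.var x, β) ∈ Θ := by
  induction h with
  | fam h => exact h.exists_mem hx
  | pi _ _ ihA ihB => exact hx.elim ihA ihB

/-- `Agree p ε ε' X`: the environments treat bound variables alike, and `ε` replaces each variable
`x` in `X` by what `ε'` puts in place of `p x`. -/
structure Env.Agree (p : Var → Var) (ε ε' : Env) (X : Var → Prop) : Prop where
  ix : ε'.ix = ε.ix
  nm : ∀ x, X x → ∃ v, ε.nm x = some v ∧ ε'.nm (p x) = some v

namespace Env.Agree

variable {p : Var → Var} {ε ε' : Env} {X Y : Var → Prop}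

theorem mono (h : Agree p ε ε' X) (hY : ∀ x, Y x → X x) : Agree p ε ε' Y :=
  ⟨h.ix, fun x hx => h.nm x (hY x hx)⟩

theorem up (h : Agree p ε ε' X) : Agree p ε.up ε'.up X := by
  refine ⟨by simp only [Env.up, h.ix], fun x hx => ?_⟩
  obtain ⟨v, h₁, h₂⟩ := h.nm x hx
  exact ⟨(v.1.shift 0, v.2), by simp only [Env.up, h₁, Option.map_some],
    by simp only [Env.up, h₂, Option.map_some]⟩

end Env.Agree

mutual
theorem SubTm.rename {p : Var → Var} {ε ε' : Env} {M M' : Tm} (h : SubTm ε M M')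
    (ha : Env.Agree p ε ε' (fun x => M.Occurs x)) : SubTm ε' (M.rename p) M' :=
  match h with
  | .atm h => .atm (SubAtm.rename h ha)
  | .lam h => .lam (SubTm.rename h ha.up)
theorem SubAtm.rename {p : Var → Var} {ε ε' : Env} {R : Atm} {M : Tm} {r : Option Arity}
    (h : SubAtm ε R M r) (ha : Env.Agree p ε ε' (fun x => R.Occurs x)) :
    SubAtm ε' (R.rename p) M r :=
  match h with
  | .const => .const
  | .nom => .nom
  | .varKeep hx => by
    obtain ⟨v, h₁, -⟩ := ha.nm _ rfl
    simp [hx] at h₁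
  | .varRepl hx => by
    obtain ⟨v, h₁, h₂⟩ := ha.nm _ rfl
    exact .varRepl (by rw [h₂, ← h₁, hx])
  | .bvarKeep hi => .bvarKeep (by rw [ha.ix, hi])
  | .bvarRepl hi => .bvarRepl (by rw [ha.ix, hi])
  | .appKeep hR hM => .appKeep (SubAtm.rename hR (ha.mono fun _ => .inl))
      (SubTm.rename hM (ha.mono fun _ => .inr))
  | .appAtm hR hM => .appAtm (SubAtm.rename hR (ha.mono fun _ => .inl))
      (SubTm.rename hM (ha.mono fun _ => .inr))
  | .appLam hR hM hN => .appLam (SubAtm.rename hR (ha.mono fun _ => .inl))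
      (SubTm.rename hM (ha.mono fun _ => .inr)) hN
end

theorem SubFam.rename {p : Var → Var} {ε ε' : Env} {P P' : Fam} (h : SubFam ε P P')
    (ha : Env.Agree p ε ε' (fun x => P.Occurs x)) : SubFam ε' (P.rename p) P' := by
  induction h with
  | const => exact .const
  | app _ hM ih =>
    exact .app (ih (ha.mono fun _ => .inl)) (hM.rename (ha.mono fun _ => .inr))

/-- The result of a substitution depends only on what is put in place of the free variables. -/
theorem SubTy.rename {p : Var → Var} {ε ε' : Env} {A A' : Ty} (h : SubTy ε A A')
    (ha : Env.Agree p ε ε' (fun x => A.Occurs x)) : SubTy ε' (A.rename p) A' := by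
  induction h generalizing ε' with
  | fam h => exact .fam (h.rename ha)
  | pi _ _ ihA ihB =>
    exact .pi (ihA (ha.mono fun _ => .inl)) (ihB (ha.mono fun _ => .inr).up)

mutual
theorem Tm.rename_id : ∀ M : Tm, M.rename id = M
  | .atm R => congrArg Tm.atm (Atm.rename_id R)
  | .lam M => congrArg Tm.lam (Tm.rename_id M)
theorem Atm.rename_id : ∀ R : Atm, R.rename id = R
  | .const _ => rfl
  | .var _ => rfl
  | .nom _ => rfl
  | .bvar _ => rfl
  | .app R M => congrArg₂ Atm.app (Atm.rename_id R) (Tm.rename_id M)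
end

theorem Fam.rename_id : ∀ P : Fam, P.rename id = P
  | .const _ => rfl
  | .app P M => congrArg₂ Fam.app (Fam.rename_id P) (Tm.rename_id M)

theorem Ty.rename_id : ∀ A : Ty, A.rename id = A
  | .fam P => congrArg Ty.fam (Fam.rename_id P)
  | .pi A B => congrArg₂ Ty.pi (Ty.rename_id A) (Ty.rename_id B)


/-! ### Instances of block schemas -/

/-- The valuation of the variables that consists in looking them up in `θ`. -/
abbrev Subst.val (θ : Subst) (x : Var) : Option (Tm × Arity) := θ.lookup x

theorem Env.comp_ofSubst (θ ρ : Subst) :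
    (Env.ofSubst θ).comp (Env.ofSubst ρ) = Env.ofSubst (θ ++ ρ) := by
  simp only [Env.comp, Env.ofSubst, List.lookup_append]

theorem DeclInst.isNominal {D : Bindings Var} {G : Ctx} {θ : Subst} (h : DeclInst D G θ) :
    (Env.ofSubst θ).IsNominal := by
  refine ⟨fun x M α hx => ?_, fun _ => rfl⟩
  change θ.lookup x = _ at hx
  induction h with
  | nil => simp at hx
  | cons _ _ _ ih =>
    rw [List.lookup_cons] at hx
    split at hx
    · exact ⟨_, (congrArg Prod.fst (Option.some.inj hx)).symm⟩
    · exact ih hx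

theorem DeclsWf.mem_or {S : Signature} {Θ Θ' : ArityCtx} {D : Bindings Var}
    (h : DeclsWf S Θ D Θ') {e : Sym × Arity} (he : e ∈ Θ') :
    e ∈ Θ ∨ ∃ b ∈ D, e = (Sym.var b.1, b.2.erase) := by
  induction h with
  | nil => exact .inl he
  | cons _ _ _ ih =>
    rcases he with he | rfl
    · exact (ih he).imp_right fun ⟨b, hb, hbe⟩ => ⟨b, List.mem_cons_of_mem _ hb, hbe⟩
    · exact .inr ⟨_, List.mem_cons_self, rfl⟩

theorem DeclsWf.mem_of_mem {S : Signature} {Θ Θ' : ArityCtx} {D : Bindings Var}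
    (h : DeclsWf S Θ D Θ') : ∀ b ∈ D, (Sym.var b.1, b.2.erase) ∈ Θ' := by
  induction h with
  | nil => simp
  | cons _ _ _ ih => exact List.forall_mem_cons.2 ⟨.inr rfl, fun b hb => .inl (ih b hb)⟩

theorem DeclsWf.nodup {S : Signature} {Θ Θ' : ArityCtx} {D : Bindings Var}
    (h : DeclsWf S Θ D Θ') : (D.map Prod.fst).Nodup := by
  induction h with
  | nil => simp
  | cons h hy _ ih =>
    refine List.nodup_cons.2 ⟨fun hmem => ?_, ih⟩
    obtain ⟨b, hb, rfl⟩ := List.mem_map.1 hmem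
    exact hy _ (h.mem_of_mem b hb)

theorem ParamSubst.exists_lookup {S : Signature} {xs : List (Var × Arity)} {ρ : Subst}
    (h : ParamSubst S xs ρ) {x : Var} {α : Arity} (hx : (x, α) ∈ xs) :
    ∃ v, ρ.lookup x = some v := by
  induction h with
  | nil => simp at hx
  | cons _ _ ih =>
    rw [List.lookup_cons]
    split
    · exact ⟨_, rfl⟩
    · rcases List.mem_cons.1 hx with hx | hx
      · cases hx; simp_all
      · exact ih hx

theorem ParamSubst.of_lookup {S : Signature} {xs : List (Var × Arity)} {ρ : Subst}
    (h : ParamSubst S xs ρ) {x : Var} {t : Tm} {α : Arity} (hx : ρ.lookup x = some (t, α)) :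
    (x, α) ∈ xs ∧ ArTm (nomCtx ∪ S.arityCtx) [] t α := by
  induction h with
  | nil => simp at hx
  | cons _ ht ih =>
    rw [List.lookup_cons] at hx
    split at hx
    · rename_i heq
      cases hx
      exact ⟨(beq_iff_eq.1 heq) ▸ List.mem_cons_self, ht⟩
    · exact (ih hx).imp_left (List.mem_cons_of_mem _)

/-- The term consisting of a nominal constant has the arity type of the constant. -/
theorem arTm_nom (S : Signature) (n : Nom) :
    ArTm (nomCtx ∪ S.arityCtx) [] (.atm (.nom n)) n.arity :=
  .atm (.nom (.inl ⟨n, rfl⟩))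

/-- A partial assignment of closed terms that respects arity types, on the parameters where it is
defined, can be completed: every arity type is inhabited by a nominal constant. -/
theorem ParamSubst.exists_compatible {S : Signature} (u : Var → Option (Tm × Arity)) :
    ∀ xs : List (Var × Arity), (∀ x α t β, (x, α) ∈ xs → u x = some (t, β) →
      α = β ∧ ArTm (nomCtx ∪ S.arityCtx) [] t β) →
    ∃ ρ, ParamSubst S xs ρ ∧ ∀ x v w, ρ.lookup x = some v → u x = some w → v = w
  | [], _ => ⟨[], .nil, by simp⟩
  | (x, α) :: xs, h => by
    obtain ⟨ρ, hρ, hu⟩ := exists_compatible u xs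
      fun y β t γ hy => h y β t γ (List.mem_cons_of_mem _ hy)
    obtain ⟨t, ht, htu⟩ : ∃ t, ArTm (nomCtx ∪ S.arityCtx) [] t α ∧
        ∀ w, u x = some w → (t, α) = w := by
      cases hx : u x with
      | none => exact ⟨_, arTm_nom S ⟨0, α⟩, by simp⟩
      | some w =>
        obtain ⟨rfl, ht⟩ := h x α w.1 w.2 List.mem_cons_self hx
        exact ⟨w.1, ht, by simp⟩
    refine ⟨(x, t, α) :: ρ, .cons hρ ht, fun y v w hy hw => ?_⟩
    rw [List.lookup_cons] at hy
    split at hy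
    · rename_i heq
      obtain rfl := beq_iff_eq.1 heq
      cases hy
      exact htu w hw
    · exact hu y v w hy hw

/-- `DeclVal v b c`: under the valuation `v`, which is defined on the free variables of the type
in the binding `b`, the binding `c` is the instance of `b`. -/
structure DeclVal (v : Var → Option (Tm × Arity)) (b : Var × Ty) (c : Nom × Ty) : Prop where
  arity : c.1.arity = b.2.erase
  val : v b.1 = some (.atm (.nom c.1), b.2.erase)
  sub : SubTy ⟨v, Sum.inr⟩ b.2 c.2
  defined : ∀ x, b.2.Occurs x → ∃ w, v x = some w

theorem DeclVal.congr {v v' : Var → Option (Tm × Arity)} {b : Var × Ty} {c : Nom × Ty}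
    (h : DeclVal v b c) (hv : ∀ x w, v x = some w → v' x = some w) : DeclVal v' b c where
  arity := h.arity
  val := hv _ _ h.val
  sub := by
    have := h.sub.rename (p := id) (ε' := ⟨v', Sum.inr⟩) ⟨rfl, fun x hx => by
      obtain ⟨w, hw⟩ := h.defined x hx
      exact ⟨w, hw, hv x w hw⟩⟩
    rwa [Ty.rename_id] at this
  defined x hx := (h.defined x hx).imp fun w => hv x w

/-- The two substitutions that form an instance of a block schema amount to a single valuation of
its parameters and declared variables by closed terms. -/
theorem BlockInst.exists_val {S : Signature} {B : BlockSchema} {G : Ctx} (hB : B.Wf S)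
    (h : BlockInst S B G) :
    ∃ v : Var → Option (Tm × Arity), List.Forall₂ (DeclVal v) B.decls G ∧
      ∀ x t α, v x = some (t, α) →
        (Sym.var x, α) ∈ B.arityCtx ∧ ArTm (nomCtx ∪ S.arityCtx) [] t α := by
  obtain ⟨hD, hρ, hG⟩ := h
  rename_i G₀ θ ρ
  obtain ⟨-, Θ', hwf⟩ := hB
  have key : List.Forall₂ (DeclVal (θ ++ ρ).val) B.decls G ∧
      (∀ x t α, (θ ++ ρ).val x = some (t, α) →
        (Sym.var x, α) ∈ Θ' ∧ ArTm (nomCtx ∪ S.arityCtx) [] t α) ∧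
      ∀ x α, (Sym.var x, α) ∈ Θ' → ∃ w, (θ ++ ρ).val x = some w := by
    generalize B.decls = D at hD hwf
    induction hD generalizing G Θ' with
    | nil =>
      cases hG
      cases hwf
      refine ⟨.nil, fun x t α hx => ?_, fun x α hx => ?_⟩
      · obtain ⟨h₁, h₂⟩ := hρ.of_lookup hx
        exact ⟨.inr ⟨_, h₁, rfl⟩, h₂⟩
      · rcases hx with ⟨c, A, -, hx⟩ | ⟨⟨y, β⟩, hy, hx⟩
        · cases hx
        · cases hx
          exact hρ.exists_lookup hy
    | @cons D G₀ θ y A A' n hD hn hA ih =>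
      cases hG with
      | cons hG hA' =>
        cases hwf with
        | cons hwf hy hAr =>
          obtain ⟨h₁, h₂, h₃⟩ := ih hG _ hwf
          -- The new entry does not override any value, as `y` is not yet in scope.
          have hext : ∀ x w, (θ ++ ρ).val x = some w →
              Subst.val ((y, .atm (.nom n), A.erase) :: θ ++ ρ) x = some w := by
            intro x w hx
            have hxy : x ≠ y := by
              rintro rfl
              exact hy _ (h₂ x w.1 w.2 hx).1
            simpa [Subst.val, List.lookup_cons, beq_false_of_ne hxy] using hx
          have hyv : Subst.val ((y, .atm (.nom n), A.erase) :: θ ++ ρ) y =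
              some (.atm (.nom n), A.erase) := by
            simp [Subst.val]
          refine ⟨.cons ?_ (h₁.imp fun _ _ h => h.congr hext), ?_, ?_⟩
          · have hcomp := hA.comp hD.isNominal hA'
            rw [Env.comp_ofSubst] at hcomp
            have hdef : ∀ x, A.Occurs x → ∃ w, (θ ++ ρ).val x = some w := fun x hx =>
              let ⟨β, hβ⟩ := hAr.exists_mem hx
              h₃ x β hβ
            have hsub := hcomp.rename (p := id)
              (ε' := ⟨Subst.val ((y, .atm (.nom n), A.erase) :: θ ++ ρ), Sum.inr⟩)
              ⟨rfl, fun x hx => by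
                obtain ⟨w, hw⟩ := hdef x hx
                exact ⟨w, hw, hext x w hw⟩⟩
            rw [Ty.rename_id] at hsub
            exact ⟨hn, hyv, hsub, fun x hx => (hdef x hx).imp fun w => hext x w⟩
          · intro x t α hx
            by_cases hxy : x = y
            · subst hxy
              obtain ⟨rfl, rfl⟩ := Prod.mk.inj (Option.some.inj (hyv.symm.trans hx))
              exact ⟨.inr rfl, hn ▸ arTm_nom S n⟩
            · obtain ⟨h, h'⟩ := h₂ x t α
                (by simpa [Subst.val, List.lookup_cons, beq_false_of_ne hxy] using hx)
              exact ⟨.inl h, h'⟩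
          · rintro x α (hx | hx)
            · exact (h₃ x α hx).imp fun w => hext x w
            · cases hx
              exact ⟨_, hyv⟩
  refine ⟨_, key.1, fun x t α hx => ?_⟩
  obtain ⟨h₁, h₂⟩ := key.2.1 x t α hx
  refine ⟨?_, h₂⟩
  rcases hwf.mem_or h₁ with (⟨_, _, _, h⟩ | h) | h
  · cases h
  · exact .inl h
  · exact .inr h

/-! ### Dropping bindings -/

/-- `Drops Q D D'`: the sequence `D` results from `D'` by dropping bindings whose types have
property `Q`. -/
inductive Drops (Q : Ty → Prop) {ι : Type} : Bindings ι → Bindings ι → Prop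
  | nil : Drops Q [] []
  | keep {G G' : Bindings ι} {n : ι} {A : Ty} :
      Drops Q G G' → Drops Q ((n, A) :: G) ((n, A) :: G')
  | drop {G G' : Bindings ι} {n : ι} {A : Ty} :
      Drops Q G G' → Q A → Drops Q G ((n, A) :: G')

namespace Drops

variable {Q : Ty → Prop} {ι : Type} {D D' : Bindings ι}

theorem subset (h : Drops Q D D') : D ⊆ D' := by
  induction h with
  | nil => exact List.Subset.refl _
  | keep _ ih => exact List.cons_subset_cons _ ih
  | drop _ _ ih => exact List.subset_cons_of_subset _ ih

theorem mem_or (h : Drops Q D D') : ∀ b ∈ D', b ∈ D ∨ Q b.2 := by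
  induction h with
  | nil => simp
  | keep _ ih =>
    exact List.forall_mem_cons.2 ⟨.inl List.mem_cons_self,
      fun b hb => (ih b hb).imp_left (List.mem_cons_of_mem _)⟩
  | drop _ hA ih => exact List.forall_mem_cons.2 ⟨.inr hA, ih⟩

theorem append {E E' : Bindings ι} (hE : Drops Q E E') (h : Drops Q D D') :
    Drops Q (E ++ D) (E' ++ D') := by
  induction hE with
  | nil => exact h
  | keep _ ih => exact .keep ih
  | drop _ hA ih => exact .drop ih hA

end Drops

/-- The types that may be dropped both for subsumption relative to `F` and `Γ` and for pruning
relative to `C`. -/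
def Droppable (S : Signature) (Γ : CtxVar) (F : Formula) (C : CtxSchema) (A : Ty) : Prop :=
  ¬ FmlSubord S Γ A F ∧ ∀ B ∈ C, ∀ b ∈ B.decls, ¬ TySubord S A b.2

variable {S : Signature} {Γ : CtxVar} {F : Formula} {C : CtxSchema} {ι : Type}
  {D D' : Bindings ι}

theorem Droppable.congr_head {A B : Ty} (hAB : A.head = B.head)
    (h : Droppable S Γ F C A) : Droppable S Γ F C B :=
  ⟨fun hF => h.1 (hF.congr_head hAB.symm), fun E hE b hb hs =>
    h.2 E hE b hb (by simpa only [TySubord, hAB] using hs)⟩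

theorem CtxSubsumes.subset (h : CtxSubsumes S Γ F D D') : D ⊆ D' := by
  induction h with
  | nil => exact List.Subset.refl _
  | keep _ ih => exact List.cons_subset_cons _ ih
  | drop _ _ ih => exact List.subset_cons_of_subset _ ih

theorem Prunes.subset (h : Prunes S C D D') : D ⊆ D' := by
  induction h with
  | nil => exact List.Subset.refl _
  | keep _ ih => exact List.cons_subset_cons _ ih
  | drop _ _ ih => exact List.subset_cons_of_subset _ ih

/-- When the bindings are to distinct objects, a sequence and the result of dropping some of its
bindings determine which ones are dropped, so that the bindings dropped in a subsumption and in a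
pruning are the same. -/
theorem Drops.of_prunes_of_subsumes (hp : Prunes S C D D') (hs : CtxSubsumes S Γ F D D')
    (hn : (D'.map Prod.fst).Nodup) : Drops (Droppable S Γ F C) D D' := by
  induction hp with
  | nil => exact .nil
  | keep hp ih =>
    obtain ⟨hn₁, hn₂⟩ := List.nodup_cons.1 hn
    cases hs with
    | keep hs => exact .keep (ih hs hn₂)
    | drop hs _ =>
      exact absurd (List.mem_map_of_mem (f := Prod.fst) (hs.subset List.mem_cons_self)) hn₁
  | drop hp hA ih =>
    obtain ⟨hn₁, hn₂⟩ := List.nodup_cons.1 hn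
    cases hs with
    | keep hs =>
      exact absurd (List.mem_map_of_mem (f := Prod.fst) (hp.subset List.mem_cons_self)) hn₁
    | drop hs hA' => exact .drop (ih hs hn₂) ⟨hA', hA⟩

theorem Drops.prunes (h : Drops (Droppable S Γ F C) D D') : Prunes S C D D' := by
  induction h with
  | nil => exact .nil
  | keep _ ih => exact .keep ih
  | drop _ hA ih => exact .drop ih hA.2

theorem Drops.subsumes (h : Drops (Droppable S Γ F C) D D') : CtxSubsumes S Γ F D D' := by
  induction h with
  | nil => exact .nil
  | keep _ ih => exact .keep ih
  | drop _ hA ih => exact .drop ih hA.1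

/-- Each type in the context has the head of some type assigned in a block schema of `C`. -/
def HeadsIn (C : CtxSchema) (G : Ctx) : Prop :=
  ∀ c ∈ G, ∃ B ∈ C, ∃ b ∈ B.decls, c.2.head = b.2.head

/-- If the context is well-formed and the types dropped are not subordinate to those kept, then
the bindings kept form a well-formed context. -/
theorem CtxWf.drops (hS : S.Respects) {G G' : Ctx} (h : CtxWf S G') (hG' : G'.Respects S)
    (hd : Drops (Droppable S Γ F C) G G') (hG : HeadsIn C G) : CtxWf S G := by
  induction hd with
  | nil => exact .nil
  | keep hd ih =>
    obtain ⟨hA, hG'⟩ := List.forall_mem_cons.1 hG'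
    obtain ⟨⟨B, hB, b, hb, hhd⟩, hG⟩ := List.forall_mem_cons.1 hG
    cases h with
    | cons h hn hnG hwf =>
      have hst : Strengthens S _ _ _ := ⟨hd.subset, fun c hc =>
        (hd.mem_or c hc).imp_right fun hQ => ⟨h.subord_refl c hc,
          fun hs => hQ.2 B hB b hb (by simpa only [TySubord, ← hhd] using hs)⟩⟩
      exact .cons (ih h hG' hG) hn (hst.notMem hnG) (hwf.strengthen hS hG' hA hst)
  | drop _ _ ih =>
    cases h with
    | cons h => exact ih h (List.forall_mem_cons.1 hG').2 hG

/-! ### Instances of matched schemas -/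

/-- An instance of a block schema whose declared variables are renamed by `p` and partly dropped:
the bindings of the instance that come from the remaining declarations form an instance of these
declarations, for any substitution `ρ` for the parameters that is compatible with the given
valuation. A dropped variable may be a parameter here; `ρ` then has to replace it by the nominal
constant that stands for it in the given instance. -/
theorem exists_declInst {p : Equiv.Perm Var} {v : Var → Option (Tm × Arity)}
    {xs : List (Var × Arity)} {ρ : Subst} (hρ : ParamSubst S xs ρ)
    (hρv : ∀ x a w, ρ.lookup x = some a → v (p.symm x) = some w → a = w)
    {D₀ D : Bindings Var} {G' : Ctx} {Θ : ArityCtx} (hv : List.Forall₂ (DeclVal v) D₀ G')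
    (hD : Drops (Droppable S Γ F C) D (D₀.map fun b => (p b.1, b.2.rename p)))
    (hwf : DeclsWf S (S.arityCtx ∪ paramCtx xs) D Θ) :
    ∃ G₀ G θ, DeclInst D G₀ θ ∧ SubCtx ρ G₀ G ∧ Drops (Droppable S Γ F C) G G' ∧
      (∀ c ∈ G, ∃ b ∈ D, c.2.head = b.2.head) ∧
      (∀ x a, θ.lookup x = some a → v (p.symm x) = some a) ∧
      ∀ b ∈ D, ∃ a, θ.lookup b.1 = some a := by
  induction hv generalizing D Θ with
  | nil =>
    cases hD
    exact ⟨[], [], [], .nil, .nil, .nil, by simp, by simp, by simp⟩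
  | @cons b c D₀ G' hb _ ih =>
    obtain ⟨n, A'⟩ := c
    cases hD with
    | drop hD hA =>
      obtain ⟨G₀, G, θ, h₁, h₂, h₃, h⟩ := ih hD hwf
      refine ⟨G₀, G, θ, h₁, h₂, .drop h₃ (hA.congr_head ?_), h⟩
      rw [Ty.head_rename, hb.sub.head_eq]
    | keep hD =>
      cases hwf with
      | cons hwf hy hAr =>
        obtain ⟨G₀, G, θ, h₁, h₂, h₃, hhd, hθ, hdom⟩ := ih hD hwf
        have hag : Env.Agree p ⟨v, Sum.inr⟩ ((Env.ofSubst θ).comp (Env.ofSubst ρ))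
            (fun x => b.2.Occurs x) := by
          refine ⟨rfl, fun x hx => ?_⟩
          obtain ⟨w, hw⟩ := hb.defined x hx
          refine ⟨w, hw, ?_⟩
          have hw' : v (p.symm (p x)) = some w := by rwa [Equiv.symm_apply_apply]
          change (θ.lookup (p x)).or (ρ.lookup (p x)) = some w
          cases hl : θ.lookup (p x) with
          | some a => exact (hθ _ _ hl).symm.trans hw'
          | none =>
            obtain ⟨β, hβ⟩ := hAr.exists_mem (hx.rename p)
            rcases hwf.mem_or hβ with (⟨_, _, _, h⟩ | ⟨⟨y', γ⟩, hq, h⟩) | ⟨⟨y', B⟩, hd, h⟩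
            · cases h
            · obtain ⟨h, -⟩ := Prod.mk.inj h
              cases h
              obtain ⟨a, ha⟩ : ∃ a, ρ.lookup (p x) = some a := hρ.exists_lookup hq
              rw [ha, hρv _ _ _ ha hw', Option.none_or]
            · obtain ⟨h, -⟩ := Prod.mk.inj h
              cases h
              obtain ⟨a, ha⟩ : ∃ a, θ.lookup (p x) = some a := hdom _ hd
              simp [hl] at ha
        obtain ⟨A₁, hA₁, hA₂⟩ := (hb.sub.rename hag).split h₁.isNominal
        refine ⟨_, _, _, .cons (n := n) h₁ (by rw [Ty.erase_rename]; exact hb.arity) hA₁,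
          .cons h₂ hA₂, .keep h₃, ?_, ?_, ?_⟩
        · refine List.forall_mem_cons.2 ⟨⟨_, List.mem_cons_self, ?_⟩, fun c hc => ?_⟩
          · rw [Ty.head_rename]
            exact hb.sub.head_eq
          · obtain ⟨d, hd, h⟩ := hhd c hc
            exact ⟨d, List.mem_cons_of_mem _ hd, h⟩
        · intro x a hx
          rw [List.lookup_cons] at hx
          split at hx
          · rename_i heq
            obtain rfl := beq_iff_eq.1 heq
            cases hx
            rw [Equiv.symm_apply_apply, Ty.erase_rename]
            exact hb.val
          · exact hθ x a hx
        · refine List.forall_mem_cons.2 ⟨⟨_, List.lookup_cons_self⟩, fun d hd => ?_⟩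
          rw [List.lookup_cons]
          split
          · exact ⟨_, rfl⟩
          · exact hdom d hd

theorem SchemaWf.wf_of_mem (h : SchemaWf S C) : ∀ B ∈ C, B.Wf S := by
  induction h with
  | nil => simp
  | cons _ hB ih => exact List.forall_mem_cons.2 ⟨hB, ih⟩

theorem SchemaInstOne.of_mem {B : BlockSchema} {G : Ctx} (hG : BlockInst S B G) :
    ∀ {C : CtxSchema}, B ∈ C → SchemaInstOne S C G
  | _ :: _, h => by
    rcases List.mem_cons.1 h with rfl | h
    · exact .here hG
    · exact .there (of_mem hG h)

theorem SchemaInstOne.exists_mem {G : Ctx} (h : SchemaInstOne S C G) :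
    ∃ B ∈ C, BlockInst S B G := by
  induction h with
  | here h => exact ⟨_, List.mem_cons_self, h⟩
  | there _ ih => exact ih.imp fun _ => .imp_left (List.mem_cons_of_mem _)

theorem BlockMatch.exists_mem {B' : BlockSchema} {E : CtxSchema} (h : BlockMatch S Γ F C B' E) :
    ∃ B ∈ E, Aligned B B' ∧ Prunes S C B.decls B'.decls ∧ CtxSubsumes S Γ F B.decls B'.decls := by
  induction h with
  | here h₁ h₂ h₃ => exact ⟨_, List.mem_cons_self, h₁, h₂, h₃⟩
  | there _ ih => exact ih.imp fun _ => .imp_left (List.mem_cons_of_mem _)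

theorem SchemaSubsumes.exists_of_mem {C' : CtxSchema} (h : SchemaSubsumes S Γ F C C') :
    ∀ B ∈ C', ∃ B', IsVariant B' B ∧ BlockMatch S Γ F C B' C := by
  induction h with
  | nil => simp
  | cons _ hv hm ih => exact List.forall_mem_cons.2 ⟨⟨_, hv, hm⟩, ih⟩

theorem BlockSchema.mem_arityCtx_rename {p : Var → Var} {B : BlockSchema} {x : Var} {α : Arity}
    (h : (Sym.var x, α) ∈ B.arityCtx) : (Sym.var (p x), α) ∈ (B.rename p).arityCtx := by
  rcases h with ⟨q, hq, h⟩ | ⟨b, hb, h⟩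
  · cases h
    exact .inl ⟨_, List.mem_map_of_mem hq, rfl⟩
  · cases h
    exact .inr ⟨_, List.mem_map_of_mem hb, by rw [Ty.erase_rename]⟩

/-- Each instance of a block schema of `C'` contains an instance of a matching block schema
of `C`. -/
theorem SchemaSubsumes.exists_inst_one {C' : CtxSchema} (hC : SchemaWf S C) (hC' : SchemaWf S C')
    (hsub : SchemaSubsumes S Γ F C C') {G' : Ctx} (hG' : SchemaInstOne S C' G') :
    ∃ G, SchemaInstOne S C G ∧ Drops (Droppable S Γ F C) G G' ∧ HeadsIn C G := by
  obtain ⟨B₀, hB₀, hinst⟩ := hG'.exists_mem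
  have hB₀wf := hC'.wf_of_mem B₀ hB₀
  obtain ⟨_, ⟨p, -, rfl⟩, hmatch⟩ := hsub.exists_of_mem B₀ hB₀
  obtain ⟨B, hB, hal, hp, hs⟩ := hmatch.exists_mem
  obtain ⟨v, hv, hvar⟩ := hinst.exists_val hB₀wf
  obtain ⟨ρ, hρ, hρv⟩ := ParamSubst.exists_compatible (S := S) (fun x => v (p.symm x)) B.params
    fun x α t β hx hxv => by
      obtain ⟨h₁, h₂⟩ := hvar _ _ _ hxv
      refine ⟨hal x α β (.inl ⟨_, hx, rfl⟩) ?_, h₂⟩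
      simpa using BlockSchema.mem_arityCtx_rename (p := p) h₁
  have hnodup : ((B₀.rename p).decls.map Prod.fst).Nodup := by
    obtain ⟨-, Θ, hΘ⟩ := hB₀wf
    have := hΘ.nodup.map p.injective
    simpa [BlockSchema.rename, Function.comp_def] using this
  obtain ⟨-, Θ, hΘ⟩ := hC.wf_of_mem B hB
  obtain ⟨G₀, G, θ, h₁, h₂, h₃, hhd, -⟩ :=
    exists_declInst hρ hρv hv (Drops.of_prunes_of_subsumes hp hs hnodup) hΘ
  exact ⟨G, .of_mem ⟨h₁, hρ, h₂⟩ hB, h₃, fun c hc => ⟨B, hB, hhd c hc⟩⟩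

theorem SchemaSubsumes.exists_inst {C' : CtxSchema} (hC : SchemaWf S C) (hC' : SchemaWf S C')
    (hsub : SchemaSubsumes S Γ F C C') {G' : Ctx} (hG' : SchemaInst S C' G') :
    ∃ G, SchemaInst S C G ∧ Drops (Droppable S Γ F C) G G' ∧ HeadsIn C G := by
  induction hG' with
  | nil => exact ⟨[], .nil, .nil, by simp [HeadsIn]⟩
  | append _ h₁ ih =>
    obtain ⟨G, hG, hd, hh⟩ := ih
    obtain ⟨G₁, hG₁, hd₁, hh₁⟩ := hsub.exists_inst_one hC hC' h₁
    exact ⟨G₁ ++ G, .append hG hG₁, hd₁.append hd,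
      fun c hc => (List.mem_append.1 hc).elim (hh₁ c) (hh c)⟩

end LLF

theorem mainTheorem2
    (S : LLF.Signature) (hS : LLF.SigWf S) (hSr : S.Respects)
    (F : LLF.Formula) (Γ : LLF.CtxVar)
    (C C' : LLF.CtxSchema) (hC : LLF.SchemaWf S C) (hC' : LLF.SchemaWf S C')
    (hsub : LLF.SchemaSubsumes S Γ F C C')
    (G' : LLF.Ctx) (hinst : LLF.SchemaInst S C' G') (hwf : LLF.CtxWf S G')
    (hGr : G'.Respects S) :
    ∃ G : LLF.Ctx, LLF.SchemaInst S C G ∧ LLF.CtxWf S G ∧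
      LLF.CtxSubsumes S Γ F G G' ∧ LLF.Prunes S C G G' := by
  obtain ⟨G, hG, hd, hh⟩ := hsub.exists_inst hC hC' hinst
  exact ⟨G, hG, hwf.drops hSr hGr hd hh, hd.subsumes, hd.prunes⟩
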